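/- Let $A>0$, $\sigma>0$, and let $h$ be a real random variable with an arbitrary distribution $P_h$. The fast fading channel $\mathcal G_{fast}$ maps an input $\mathbf x\in\mathbb R^n$ to $y_t=h_tx_t+z_t$, $t=1,\dots,n$, where $h_1,\dots,h_n$ are i.i.d. with distribution $P_h$ and, independently of them, $z_1,\dots,z_n$ are i.i.d. $N(0,\sigma^2)$; let $P_{\mathbf h}$ be the law of $\mathbf h=(h_1,\dots,h_n)$ and $f_{\mathbf z}(\mathbf z)=(2\pi\sigma^2)^{-n/2}e^{-\|\mathbf z\|_2^2/(2\sigma^2)}$. An $(M,n,\lambda_1,\lambda_2)$ deterministic identification (DI) code for this channel with channel side information (CSI) under the input constraint $A$ consists of codewords $\mathbf u_1,\dots,\mathbf u_M\in\mathbb R^n$ with $\|\mathbf u_i\|_2^2\le nA$ and decoding regions $D_{i,\mathbf h}\subset\mathbb R^n$ ($1\le i\le M$, $\mathbf h\in\mathbb R^n$), measurable in the sense that each $\{(\mathbf h,\mathbf y):\mathbf y\in D_{i,\mathbf h}\}$ is a Borel set, such that for all $i\ne j$ $$\int\int_{D_{i,\mathbf h}^c} f_{\mathbf z}(\mathbf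 y-\mathrm{diag}(\mathbf h)\mathbf u_i)\,d\mathbf y\,dP_{\mathbf h}\le\lambda_1,\qquad \int\int_{D_{j,\mathbf h}} f_{\mathbf z}(\mathbf y-\mathrm{diag}(\mathbf h)\mathbf u_i)\,d\mathbf y\,dP_{\mathbf h}\le\lambda_2$$ (the first inequality being required for every $i$). A rate $R>0$ is achievable if for all $\lambda_1,\lambda_2>0$ and all sufficiently large $n$ there is a $(\lfloor n^{nR}\rfloor,n,\lambda_1,\lambda_2)$ DI code. The capacity $C_{DI}^{CSI}(\mathcal G_{fast})\in[0,\infty]$ is the supremum of the achievable rates ($0$ if there are none). Theorem. 1. If $\mathbb E h^2<\infty$, then $C_{DI}^{CSI}(\mathcal G_{fast})\le 1/2$. 2. If $\mathbb P(h=0)=0$, then $C_{DI}^{CSI}(\mathcal G_{fast})\ge 1/4$. 3. If $\mathbb P(h=0)<1$ and $\mathbb E h^4<\infty$, then $C_{DI}^{CSI}(\mathcal G_{fast})\ge 1/4$. -/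

import Mathlib

open MeasureTheory Filter
open scoped ENNReal

namespace FastFading

noncomputable section

/-- Squared Euclidean norm `‖x‖₂²` of a vector of `ℝⁿ`. -/
def sqNorm {n : ℕ} (x : Fin n → ℝ) : ℝ := ∑ t, x t ^ 2

/-- Density of `n` i.i.d. `N(0, σ²)` noise variables:
`f_Z(z) = (2πσ²)^(-n/2) exp(-‖z‖₂² / (2σ²))`. -/
def noiseDensity (σ : ℝ) {n : ℕ} (z : Fin n → ℝ) : ℝ :=
  1 / (2 * Real.pi * σ ^ 2) ^ ((n : ℝ) / 2) * Real.exp (-sqNorm z / (2 * σ ^ 2))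

/-- The joint law of the `n` i.i.d. fading coefficients `𝐡 = (h₁, …, hₙ)`, each with law `P_h`. -/
def fadingLaw (Ph : Measure ℝ) (n : ℕ) : Measure (Fin n → ℝ) :=
  Measure.pi fun _ => Ph

/-- A DI code with `M` codewords and length `n` for the fast fading channel with channel side
information, under the input constraint `A`: the decoding regions may depend on the realization
`𝐡` of the fading vector, and do so measurably. -/
structure DICode (A : ℝ) (M n : ℕ) where
  /-- the codewords `𝐮ᵢ` -/
  u : Fin M → Fin n → ℝ
  /-- the decoding regions `D_{i,𝐡}` -/
  D : Fin M → (Fin n → ℝ) → Set (Fin n → ℝ)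
  power : ∀ i, sqNorm (u i) ≤ n * A
  measurable_D : ∀ i, MeasurableSet {p : (Fin n → ℝ) × (Fin n → ℝ) | p.2 ∈ D i p.1}

/-- Type I error `P_{e,1}(i) = ∫ ∫_{D_{i,𝐡}ᶜ} f_Z(𝐲 - diag(𝐡) 𝐮ᵢ) d𝐲 dP_𝐡`. -/
def DICode.err₁ {A : ℝ} {M n : ℕ} (C : DICode A M n) (Ph : Measure ℝ) (σ : ℝ) (i : Fin M) :
    ℝ≥0∞ :=
  ∫⁻ h, ∫⁻ y in (C.D i h)ᶜ,
    ENNReal.ofReal (noiseDensity σ fun t => y t - h t * C.u i t) ∂volume ∂fadingLaw Ph n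

/-- Type II error `P_{e,2}(i,j) = ∫ ∫_{D_{j,𝐡}} f_Z(𝐲 - diag(𝐡) 𝐮ᵢ) d𝐲 dP_𝐡`. -/
def DICode.err₂ {A : ℝ} {M n : ℕ} (C : DICode A M n) (Ph : Measure ℝ) (σ : ℝ) (i j : Fin M) :
    ℝ≥0∞ :=
  ∫⁻ h, ∫⁻ y in C.D j h,
    ENNReal.ofReal (noiseDensity σ fun t => y t - h t * C.u i t) ∂volume ∂fadingLaw Ph n

/-- `C` is an `(M, n, l₁, l₂)` DI code. -/
def DICode.IsReliable {A : ℝ} {M n : ℕ} (C : DICode A M n) (Ph : Measure ℝ) (σ l₁ l₂ : ℝ) :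
    Prop :=
  (∀ i, C.err₁ Ph σ i ≤ ENNReal.ofReal l₁) ∧
    ∀ i j, i ≠ j → C.err₂ Ph σ i j ≤ ENNReal.ofReal l₂

/-- The rate `R > 0` is achievable: for all `l₁, l₂ > 0` and all sufficiently large `n` there is an
`(n^{nR}, n, l₁, l₂)` DI code, the number `n^{nR}` being rounded down when it is not an integer. -/
def Achievable (Ph : Measure ℝ) (A σ R : ℝ) : Prop :=
  0 < R ∧ ∀ l₁ l₂ : ℝ, 0 < l₁ → 0 < l₂ → ∀ᶠ n : ℕ in atTop,
    ∃ C : DICode A ⌊(n : ℝ) ^ ((n : ℝ) * R)⌋₊ n, C.IsReliable Ph σ l₁ l₂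

/-- The DI capacity of the fast fading channel with channel side information: the supremum, in
`[0, ∞]`, of the achievable rates. -/
def capacity (Ph : Measure ℝ) (A σ : ℝ) : ℝ≥0∞ :=
  ⨆ (R : ℝ) (_ : Achievable Ph A σ R), ENNReal.ofReal R

end

end FastFading

/-! Converse: if two codewords are so close that the outputs `h * u i + z` and `h * u j + z` have
nearly the same law, no region can accept one and reject the other. A total variation estimate
(`noiseLaw_shift_le`), averaged over the fading, involves only the mean of `sqNorm (h * d)`, which
is the second moment of the fading times `sqNorm d`. Codewords are therefore separated by a constant
independent of `n`. Packing balls into the ball of radius `√(n * A)` (`card_le_of_separated`) leaves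
at most `(K * √n) ^ n` codewords, hence rate at most 1/2.

Achievability: place codewords on a grid with about `n ^ b` levels per coordinate, `b < 1/4`, and
use a Gilbert–Varshamov code (`exists_separated_code`) so that two words differ in at least `θ * n`
coordinates. If the fading is not almost surely zero, `h ^ 2` exceeds some `c > 0` with positive
probability, so a fixed fraction of these coordinates survives and the faded squared distance is of
order `n ^ (1 - 2 * b)`. This beats the fluctuations of order `√n` of the squared noise norm, so a
distance threshold decoder works (`thresholdCode_isReliable`). The code has about `n ^ (n * b * (1 -
θ))` words; `b → 1/4`, `θ → 0` gives every rate below 1/4. -/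

namespace FastFading

open ProbabilityTheory

noncomputable section

/-! ### The Gaussian noise law and its density -/

/-- The law `N(0, σ²)` of one noise variable. -/
def noise₁ (σ : ℝ) : Measure ℝ := gaussianReal 0 (σ ^ 2).toNNReal

/-- The joint law of `n` i.i.d. `N(0, σ²)` noise variables. -/
def noiseLaw (σ : ℝ) (n : ℕ) : Measure (Fin n → ℝ) := Measure.pi fun _ => noise₁ σ

instance (σ : ℝ) : IsProbabilityMeasure (noise₁ σ) := by unfold noise₁; infer_instance

instance (σ : ℝ) (n : ℕ) : IsProbabilityMeasure (noiseLaw σ n) := by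
  unfold noiseLaw; infer_instance

instance (Ph : Measure ℝ) [IsProbabilityMeasure Ph] (n : ℕ) :
    IsProbabilityMeasure (fadingLaw Ph n) := by
  unfold fadingLaw; infer_instance

lemma measurable_noiseDensity (σ : ℝ) (n : ℕ) :
    Measurable (noiseDensity σ : (Fin n → ℝ) → ℝ) := by
  unfold noiseDensity sqNorm
  fun_prop

lemma noiseDensity_pos {σ : ℝ} (hσ : 0 < σ) {n : ℕ} (z : Fin n → ℝ) : 0 < noiseDensity σ z := by
  unfold noiseDensity
  have : 0 < 2 * Real.pi * σ ^ 2 := by positivity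
  positivity

lemma noiseDensity_eq_prod {σ : ℝ} (hσ : 0 < σ) {n : ℕ} (z : Fin n → ℝ) :
    noiseDensity σ z = ∏ t, gaussianPDFReal 0 (σ ^ 2).toNNReal (z t) := by
  have h2 : 0 ≤ 2 * Real.pi * σ ^ 2 := by positivity
  have h1 : ((σ ^ 2).toNNReal : ℝ) = σ ^ 2 := Real.coe_toNNReal _ (sq_nonneg σ)
  simp only [gaussianPDFReal, h1, sub_zero]
  rw [Finset.prod_mul_distrib, ← Real.exp_sum, Finset.prod_const, Finset.card_univ,
    Fintype.card_fin, noiseDensity, sqNorm, inv_pow, one_div]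
  congr 2
  · rw [Real.sqrt_eq_rpow, ← Real.rpow_mul_natCast h2]
    congr 1; ring
  · rw [← Finset.sum_div, Finset.sum_neg_distrib]

/-- A product measure is determined by its values on boxes, and on a box both the density and the
indicator factor over the coordinates. -/
lemma volume_withDensity_noiseDensity {σ : ℝ} (hσ : 0 < σ) (n : ℕ) :
    (volume : Measure (Fin n → ℝ)).withDensity (fun z => ENNReal.ofReal (noiseDensity σ z)) =
      noiseLaw σ n := by
  have hv : (σ ^ 2).toNNReal ≠ 0 := by
    simpa using hσ.ne'
  refine (Measure.pi_eq fun s hs => ?_).symm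
  have hg : ∀ t, Integrable ((s t).indicator (gaussianPDFReal 0 (σ ^ 2).toNNReal)) volume :=
    fun t => (integrable_gaussianPDFReal _ _).indicator (hs t)
  have h0 : ∀ t x, 0 ≤ (s t).indicator (gaussianPDFReal 0 (σ ^ 2).toNNReal) x := fun t x =>
    Set.indicator_nonneg (fun _ _ => gaussianPDFReal_nonneg _ _ _) _
  have key : (fun z : Fin n → ℝ => (Set.univ.pi s).indicator
        (fun z => ENNReal.ofReal (noiseDensity σ z)) z) =
      fun z => ENNReal.ofReal
        (∏ t, (s t).indicator (gaussianPDFReal 0 (σ ^ 2).toNNReal) (z t)) := by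
    funext z
    by_cases hz : z ∈ Set.univ.pi s
    · rw [Set.indicator_of_mem hz, noiseDensity_eq_prod hσ]
      congr 1
      exact Finset.prod_congr rfl fun t _ => (Set.indicator_of_mem (hz t trivial) _).symm
    · rw [Set.indicator_of_notMem hz]
      simp only [Set.mem_pi, Set.mem_univ, true_imp_iff, not_forall] at hz
      obtain ⟨t, ht⟩ := hz
      rw [Finset.prod_eq_zero (Finset.mem_univ t) (Set.indicator_of_notMem ht _),
        ENNReal.ofReal_zero]
  rw [withDensity_apply _ (MeasurableSet.univ_pi hs),
    ← lintegral_indicator (MeasurableSet.univ_pi hs), key,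
    ← ofReal_integral_eq_lintegral_ofReal (μ := (volume : Measure (Fin n → ℝ)))
      (Integrable.fintype_prod hg) (ae_of_all _ fun z => Finset.prod_nonneg fun t _ => h0 t _),
    integral_fintype_prod_volume_eq_prod,
    ENNReal.ofReal_prod_of_nonneg fun t _ => integral_nonneg (h0 t)]
  refine Finset.prod_congr rfl fun t _ => ?_
  rw [integral_indicator (hs t), noise₁, gaussianReal_apply_eq_integral _ hv]

/-- Integrals against the shifted noise density are integrals over the noise. -/
lemma setLIntegral_noiseDensity_sub {σ : ℝ} (hσ : 0 < σ) {n : ℕ} (c : Fin n → ℝ)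
    {S : Set (Fin n → ℝ)} (hS : MeasurableSet S) :
    ∫⁻ y in S, ENNReal.ofReal (noiseDensity σ fun t => y t - c t) =
      noiseLaw σ n {z | z + c ∈ S} := by
  have hS' : MeasurableSet {z : Fin n → ℝ | z + c ∈ S} := measurable_add_const c hS
  rw [← volume_withDensity_noiseDensity hσ, withDensity_apply _ hS', ← lintegral_indicator hS,
    ← lintegral_indicator hS', ← lintegral_add_right_eq_self _ c]
  refine lintegral_congr fun z => ?_
  simp only [Set.indicator, Pi.add_apply, add_sub_cancel_right]
  rfl

lemma lintegral_noiseDensity_mul {σ : ℝ} (hσ : 0 < σ) {n : ℕ} (c : Fin n → ℝ)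
    {g : (Fin n → ℝ) → ℝ≥0∞} (hg : Measurable g) :
    ∫⁻ y : Fin n → ℝ, ENNReal.ofReal (noiseDensity σ fun t => y t - c t) * g (fun t => y t - c t) =
      ∫⁻ z, g z ∂noiseLaw σ n := by
  rw [← volume_withDensity_noiseDensity hσ,
    lintegral_withDensity_eq_lintegral_mul _ (measurable_noiseDensity σ n).ennreal_ofReal hg,
    ← lintegral_add_right_eq_self (fun y : Fin n → ℝ => _ * _) c]
  simp

/-! ### Second moments of sums of independent coordinates -/

/-- Chebyshev's inequality, since variances of functions of independent coordinates add. -/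
lemma measure_pi_abs_sum_sub_ge_le {n : ℕ} (μ : Measure ℝ) [IsProbabilityMeasure μ]
    {X : Fin n → ℝ → ℝ} (hX : ∀ t, MemLp (X t) 2 μ) {c : ℝ} (hc : 0 < c) :
    Measure.pi (fun _ => μ) {ω : Fin n → ℝ | c ≤ |∑ t, X t (ω t) - ∑ t, ∫ x, X t x ∂μ|} ≤
      ENNReal.ofReal ((∑ t, Var[X t; μ]) / c ^ 2) := by
  have hm : ∀ t, MemLp (fun ω : Fin n → ℝ => X t (ω t)) 2 (Measure.pi fun _ => μ) := fun t =>
    (hX t).comp_measurePreserving (measurePreserving_eval _ t)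
  have h := meas_ge_le_variance_div_sq (memLp_finsetSum' Finset.univ fun t _ => hm t) hc
  rw [variance_sum_pi hX] at h
  have hE : ∫ ω : Fin n → ℝ, (∑ t, fun ω : Fin n → ℝ => X t (ω t)) ω ∂(Measure.pi fun _ => μ) =
      ∑ t, ∫ x, X t x ∂μ := by
    simp only [Finset.sum_apply]
    rw [integral_finsetSum _ fun t _ => (hm t).integrable one_le_two]
    refine Finset.sum_congr rfl fun t _ => ?_
    exact integral_comp_eval (μ := fun _ : Fin n => μ) (hX t).1
  rw [hE] at h
  simpa only [Finset.sum_apply] using h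

lemma memLp_noise₁ (σ : ℝ) : MemLp (fun x => x) 2 (noise₁ σ) :=
  memLp_id_gaussianReal' 2 (by simp)

lemma integral_noise₁ (σ : ℝ) : ∫ x, x ∂noise₁ σ = 0 := integral_id_gaussianReal

lemma variance_noise₁ (σ : ℝ) : Var[fun x => x; noise₁ σ] = σ ^ 2 := by
  rw [noise₁, variance_fun_id_gaussianReal, Real.coe_toNNReal _ (sq_nonneg σ)]

lemma variance_const_mul_noise₁ (σ a : ℝ) : Var[fun x => a * x; noise₁ σ] = a ^ 2 * σ ^ 2 := by
  rw [variance_const_mul a (fun x => x), variance_noise₁]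

lemma integral_const_mul_noise₁ (σ a : ℝ) : ∫ x, a * x ∂noise₁ σ = 0 := by
  rw [integral_const_mul, integral_noise₁, mul_zero]

lemma integral_sq_noise₁ (σ : ℝ) : ∫ x, x ^ 2 ∂noise₁ σ = σ ^ 2 := by
  have h := variance_eq_integral (μ := noise₁ σ) (X := fun x => x) (by fun_prop)
  rw [variance_noise₁, integral_noise₁] at h
  simpa using h.symm

lemma memLp_sq_noise₁ (σ : ℝ) : MemLp (fun x => x ^ 2) 2 (noise₁ σ) := by
  have h : MemLp (fun x : ℝ => x) 4 (noise₁ σ) := memLp_id_gaussianReal' 4 (by simp)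
  have h' := MemLp.mul (p := 4) (q := 4) (r := 2) h h (hpqr := ⟨by
    rw [← two_mul, show (4 : ℝ≥0∞) = 2 * 2 by norm_num, ENNReal.mul_inv (by simp) (by simp),
      ← mul_assoc, ENNReal.mul_inv_cancel (by simp) (by simp), one_mul]⟩)
  refine h'.ae_eq (ae_of_all _ fun x => ?_)
  simp [sq]

/-- Chebyshev's inequality for the projection of the noise on a vector. -/
lemma noiseLaw_abs_inner_ge_le (σ : ℝ) {n : ℕ} (w : Fin n → ℝ) {c : ℝ} (hc : 0 < c) :
    noiseLaw σ n {z | c ≤ |∑ t, w t * z t|} ≤ ENNReal.ofReal (σ ^ 2 * sqNorm w / c ^ 2) := by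
  have h := measure_pi_abs_sum_sub_ge_le (noise₁ σ) (X := fun t x => w t * x)
    (fun t => (memLp_noise₁ σ).const_mul (w t)) hc
  simp only [integral_const_mul_noise₁, variance_const_mul_noise₁, Finset.sum_const_zero,
    sub_zero] at h
  rwa [← Finset.sum_mul, mul_comm] at h

lemma lintegral_noiseLaw_inner_sq (σ : ℝ) {n : ℕ} (w : Fin n → ℝ) :
    ∫⁻ z, ENNReal.ofReal ((∑ t, w t * z t) ^ 2) ∂noiseLaw σ n =
      ENNReal.ofReal (σ ^ 2 * sqNorm w) := by
  have hX : ∀ t, MemLp (fun x => w t * x) 2 (noise₁ σ) := fun t => (memLp_noise₁ σ).const_mul _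
  have hm : ∀ t, MemLp (fun z : Fin n → ℝ => w t * z t) 2 (noiseLaw σ n) := fun t =>
    (hX t).comp_measurePreserving (measurePreserving_eval _ t)
  have hs : MemLp (fun z : Fin n → ℝ => ∑ t, w t * z t) 2 (noiseLaw σ n) :=
    memLp_finsetSum Finset.univ fun t _ => hm t
  have h := variance_sum_pi (μ := fun _ : Fin n => noise₁ σ) hX
  have hE : ∫ z : Fin n → ℝ, ∑ t, w t * z t ∂noiseLaw σ n = 0 := by
    rw [integral_finsetSum _ fun t _ => (hm t).integrable one_le_two]
    refine Finset.sum_eq_zero fun t _ => ?_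
    rw [integral_const_mul]
    have := integral_comp_eval (μ := fun _ : Fin n => noise₁ σ) (i := t) (f := fun x => x)
      (memLp_noise₁ σ).1
    rw [noiseLaw, this, integral_noise₁, mul_zero]
  have hf : (∑ t, fun z : Fin n → ℝ => w t * z t) = fun z => ∑ t, w t * z t := by
    ext z; simp
  rw [hf] at h
  change Var[_; noiseLaw σ n] = _ at h
  rw [variance_of_integral_eq_zero hs.1.aemeasurable hE] at h
  simp only [variance_const_mul_noise₁] at h
  rw [← Finset.sum_mul, mul_comm] at h
  rw [← ofReal_integral_eq_lintegral_ofReal hs.integrable_sq (ae_of_all _ fun _ => sq_nonneg _)]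
  exact congrArg _ h

/-- Chebyshev's inequality for the squared norm of the noise. -/
lemma noiseLaw_abs_sqNorm_ge_le (σ : ℝ) (n : ℕ) {c : ℝ} (hc : 0 < c) :
    noiseLaw σ n {z | c ≤ |sqNorm z - n * σ ^ 2|} ≤
      ENNReal.ofReal (n * Var[fun x => x ^ 2; noise₁ σ] / c ^ 2) := by
  have h := measure_pi_abs_sum_sub_ge_le (n := n) (noise₁ σ) (X := fun _ x => x ^ 2)
    (fun _ => memLp_sq_noise₁ σ) hc
  simpa [integral_sq_noise₁, noiseLaw, sqNorm] using h

lemma sqNorm_nonneg {n : ℕ} (x : Fin n → ℝ) : 0 ≤ sqNorm x :=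
  Finset.sum_nonneg fun _ _ => sq_nonneg _

lemma measurable_sqNorm (n : ℕ) : Measurable (sqNorm : (Fin n → ℝ) → ℝ) := by
  unfold sqNorm; fun_prop

lemma sqNorm_add {n : ℕ} (z w : Fin n → ℝ) :
    sqNorm (z + w) = sqNorm z + 2 * ∑ t, w t * z t + sqNorm w := by
  simp only [sqNorm, Pi.add_apply, Finset.mul_sum, ← Finset.sum_add_distrib]
  exact Finset.sum_congr rfl fun t _ => by ring

/-! ### Total variation distance of shifted noise -/

/-- The likelihood ratio is the exponential of `-(r / σ ^ 2 + sqNorm w / (2 * σ ^ 2))`, bounded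
below by its tangent line. Trading the linear term in `r` for a square costs 1/4 and leaves only a
second moment to compute. -/
lemma noiseDensity_le_add {σ : ℝ} (hσ : 0 < σ) {n : ℕ} (z w : Fin n → ℝ) :
    noiseDensity σ z ≤ noiseDensity σ (z + w) + noiseDensity σ z *
      (1 / 4 + sqNorm w / (2 * σ ^ 2) + (∑ t, w t * z t) ^ 2 / σ ^ 4) := by
  set r := ∑ t, w t * z t with hr
  have hs : noiseDensity σ (z + w) =
      noiseDensity σ z * Real.exp (-(r / σ ^ 2 + sqNorm w / (2 * σ ^ 2))) := by
    unfold noiseDensity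
    rw [mul_assoc _ (Real.exp _), ← Real.exp_add, sqNorm_add, ← hr]
    congr 2
    field_simp
    ring
  have h1 : 1 - (r / σ ^ 2 + sqNorm w / (2 * σ ^ 2)) ≤
      Real.exp (-(r / σ ^ 2 + sqNorm w / (2 * σ ^ 2))) := by
    linarith [Real.add_one_le_exp (-(r / σ ^ 2 + sqNorm w / (2 * σ ^ 2)))]
  have h2 : r / σ ^ 2 ≤ 1 / 4 + r ^ 2 / σ ^ 4 := by
    have : r ^ 2 / σ ^ 4 = (r / σ ^ 2) ^ 2 := by rw [div_pow]; ring
    rw [this]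
    nlinarith [sq_nonneg (r / σ ^ 2 - 1 / 2)]
  rw [hs, ← mul_add]
  refine le_mul_of_one_le_right (noiseDensity_pos hσ z).le ?_
  linarith

/-- Integrating the pointwise bound gives the coefficient 1/2 + 1 = 3/2, as the inner product has
second moment `σ ^ 2 * sqNorm w`. The constant 1/4 is harmless: it only has to stay below 1 together
with the two error bounds. -/
lemma noiseLaw_shift_le {σ : ℝ} (hσ : 0 < σ) {n : ℕ} (a b : Fin n → ℝ) {S : Set (Fin n → ℝ)}
    (hS : MeasurableSet S) :
    noiseLaw σ n {z | z + a ∈ S} ≤ noiseLaw σ n {z | z + b ∈ S} +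
      ENNReal.ofReal (1 / 4 + 3 / (2 * σ ^ 2) * sqNorm (a - b)) := by
  set w := a - b with hw
  have h0 := sqNorm_nonneg w
  let g : (Fin n → ℝ) → ℝ≥0∞ := fun z =>
    ENNReal.ofReal (1 / 4 + sqNorm w / (2 * σ ^ 2) + (∑ t, w t * z t) ^ 2 / σ ^ 4)
  have hg : Measurable g := by fun_prop
  have hgi : ∫⁻ z, g z ∂noiseLaw σ n = ENNReal.ofReal (1 / 4 + 3 / (2 * σ ^ 2) * sqNorm w) := by
    have e : ∀ z, g z = ENNReal.ofReal (1 / 4 + sqNorm w / (2 * σ ^ 2)) +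
        ENNReal.ofReal (1 / σ ^ 4) * ENNReal.ofReal ((∑ t, w t * z t) ^ 2) := by
      intro z
      rw [← ENNReal.ofReal_mul (by positivity), ← ENNReal.ofReal_add (by positivity)
        (by positivity)]
      exact congrArg ENNReal.ofReal (by ring)
    simp only [e]
    rw [lintegral_add_left measurable_const, lintegral_const_mul _ (by fun_prop),
      lintegral_noiseLaw_inner_sq, lintegral_const, measure_univ, mul_one,
      ← ENNReal.ofReal_mul (by positivity), ← ENNReal.ofReal_add (by positivity) (by positivity)]
    congr 1
    field_simp
    ring
  rw [← hgi, ← setLIntegral_noiseDensity_sub hσ a hS, ← setLIntegral_noiseDensity_sub hσ b hS,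
    ← lintegral_noiseDensity_mul hσ a hg]
  have hm : ∀ c : Fin n → ℝ, Measurable fun y : Fin n → ℝ =>
      ENNReal.ofReal (noiseDensity σ fun t => y t - c t) := fun c =>
    ((measurable_noiseDensity σ n).comp (by fun_prop)).ennreal_ofReal
  refine le_trans ?_ (add_le_add le_rfl (setLIntegral_le_lintegral S _))
  rw [← lintegral_add_left (hm b)]
  refine lintegral_mono fun y => ?_
  have h := noiseDensity_le_add hσ (fun t => y t - a t) w
  have hy : (fun t => y t - a t) + w = fun t => y t - b t := by
    ext t; simp [hw]
  rw [hy] at h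
  have hp := noiseDensity_pos hσ fun t => y t - a t
  have hp' := noiseDensity_pos hσ fun t => y t - b t
  rw [← ENNReal.ofReal_mul hp.le, ← ENNReal.ofReal_add hp'.le
    (mul_nonneg hp.le (by positivity))]
  exact ENNReal.ofReal_le_ofReal h

/-! ### Error probabilities as probabilities of noise events -/

lemma DICode.measurableSet_D {n : ℕ} {A : ℝ} {M : ℕ} (C : DICode A M n) (i : Fin M)
    (h : Fin n → ℝ) : MeasurableSet (C.D i h) :=
  measurable_prodMk_left (C.measurable_D i)

lemma DICode.err₁_eq {A σ : ℝ} (hσ : 0 < σ) {M n : ℕ} (C : DICode A M n) (Ph : Measure ℝ)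
    (i : Fin M) :
    C.err₁ Ph σ i = ∫⁻ h, noiseLaw σ n {z | z + h * C.u i ∈ C.D i h}ᶜ ∂fadingLaw Ph n :=
  lintegral_congr fun h =>
    setLIntegral_noiseDensity_sub hσ (h * C.u i) (C.measurableSet_D i h).compl

lemma DICode.err₂_eq {A σ : ℝ} (hσ : 0 < σ) {M n : ℕ} (C : DICode A M n) (Ph : Measure ℝ)
    (i j : Fin M) :
    C.err₂ Ph σ i j = ∫⁻ h, noiseLaw σ n {z | z + h * C.u i ∈ C.D j h} ∂fadingLaw Ph n :=
  lintegral_congr fun h =>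
    setLIntegral_noiseDensity_sub hσ (h * C.u i) (C.measurableSet_D j h)

lemma DICode.measurable_noiseLaw_section {A : ℝ} (σ : ℝ) {M n : ℕ} (C : DICode A M n)
    (v : Fin n → ℝ) (j : Fin M) :
    Measurable fun h => noiseLaw σ n {z | z + h * v ∈ C.D j h} := by
  have hm : Measurable fun p : (Fin n → ℝ) × (Fin n → ℝ) => (p.1, p.2 + p.1 * v) := by fun_prop
  exact measurable_measure_prodMk_left (hm (C.measurable_D j))

/-! ### The converse -/

lemma lintegral_fadingLaw_sqNorm_mul {Ph : Measure ℝ} [IsProbabilityMeasure Ph]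
    (hint : Integrable (fun x : ℝ => x ^ 2) Ph) {n : ℕ} (d : Fin n → ℝ) :
    ∫⁻ h, ENNReal.ofReal (sqNorm (h * d)) ∂fadingLaw Ph n =
      ENNReal.ofReal ((∫ x, x ^ 2 ∂Ph) * sqNorm d) := by
  have hi : ∀ t, Integrable (fun h : Fin n → ℝ => h t ^ 2 * d t ^ 2) (fadingLaw Ph n) := fun t =>
    (integrable_comp_eval (μ := fun _ : Fin n => Ph) (i := t) hint).mul_const _
  have he : (fun h : Fin n → ℝ => sqNorm (h * d)) = fun h => ∑ t, h t ^ 2 * d t ^ 2 := by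
    ext h; simp [sqNorm, mul_pow]
  have hi' : Integrable (fun h : Fin n → ℝ => sqNorm (h * d)) (fadingLaw Ph n) := by
    rw [he]; exact integrable_finsetSum _ fun t _ => hi t
  rw [← ofReal_integral_eq_lintegral_ofReal hi' (ae_of_all _ fun _ => sqNorm_nonneg _), he,
    integral_finsetSum _ fun t _ => hi t, sqNorm, Finset.mul_sum]
  congr 1
  refine Finset.sum_congr rfl fun t _ => ?_
  rw [integral_mul_const]
  congr 1
  exact integral_comp_eval (μ := fun _ : Fin n => Ph) (i := t) (f := fun x => x ^ 2) hint.1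

/-- Codewords of a reliable code are separated. -/
lemma DICode.IsReliable.le_sqNorm_sub {Ph : Measure ℝ} [IsProbabilityMeasure Ph]
    (hint : Integrable (fun x : ℝ => x ^ 2) Ph) {A σ : ℝ} (hσ : 0 < σ) {M n : ℕ}
    {C : DICode A M n} (hC : C.IsReliable Ph σ (1 / 4) (1 / 4)) {i j : Fin M} (hij : i ≠ j) :
    σ ^ 2 / (8 * (∫ x, x ^ 2 ∂Ph + 1)) ≤ sqNorm (C.u i - C.u j) := by
  set d := C.u i - C.u j with hd
  set m := ∫ x, x ^ 2 ∂Ph with hm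
  have hm0 : 0 ≤ m := integral_nonneg fun x => sq_nonneg x
  have hd0 := sqNorm_nonneg d
  have h1 := hC.1 i
  have h2 := hC.2 j i hij.symm
  rw [DICode.err₁_eq hσ] at h1
  rw [DICode.err₂_eq hσ] at h2
  -- The same region `C.D i h` must catch the output of `u i` and miss that of `u j`.
  have key : ∀ h : Fin n → ℝ, 1 ≤ noiseLaw σ n {z | z + h * C.u i ∈ C.D i h}ᶜ +
      (noiseLaw σ n {z | z + h * C.u j ∈ C.D i h} + (ENNReal.ofReal (1 / 4) +
        ENNReal.ofReal (3 / (2 * σ ^ 2)) * ENNReal.ofReal (sqNorm (h * d)))) := by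
    intro h
    have hS := C.measurableSet_D i h
    have hS' : MeasurableSet {z : Fin n → ℝ | z + h * C.u i ∈ C.D i h} := measurable_add_const _ hS
    have := noiseLaw_shift_le hσ (h * C.u i) (h * C.u j) hS
    rw [← mul_sub, ← hd, ENNReal.ofReal_add (by positivity)
      (mul_nonneg (by positivity) (sqNorm_nonneg _)), ENNReal.ofReal_mul (by positivity)] at this
    calc 1 = noiseLaw σ n {z | z + h * C.u i ∈ C.D i h}ᶜ +
          noiseLaw σ n {z | z + h * C.u i ∈ C.D i h} := by
          rw [add_comm, measure_add_measure_compl hS', measure_univ]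
      _ ≤ _ := by gcongr
  have hmu : ∀ v, Measurable fun h => noiseLaw σ n {z | z + h * v ∈ C.D i h} := fun v =>
    C.measurable_noiseLaw_section σ v i
  have hmc : Measurable fun h => noiseLaw σ n {z | z + h * C.u i ∈ C.D i h}ᶜ := by
    have : ∀ h, noiseLaw σ n {z | z + h * C.u i ∈ C.D i h}ᶜ =
        1 - noiseLaw σ n {z | z + h * C.u i ∈ C.D i h} := fun h =>
      prob_compl_eq_one_sub (measurable_add_const _ (C.measurableSet_D i h))
    simp only [this]
    exact measurable_const.sub (hmu _)
  have hms : Measurable fun h : Fin n → ℝ => ENNReal.ofReal (sqNorm (h * d)) :=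
    ((measurable_sqNorm n).comp (by fun_prop)).ennreal_ofReal
  have hI := lintegral_mono (μ := fadingLaw Ph n) key
  rw [lintegral_const, measure_univ, mul_one, lintegral_add_left hmc, lintegral_add_left (hmu _),
    lintegral_add_left measurable_const, lintegral_const, measure_univ, mul_one,
    lintegral_const_mul _ hms, lintegral_fadingLaw_sqNorm_mul hint, ← hm] at hI
  have hI' := hI.trans (add_le_add h1 (add_le_add h2 le_rfl))
  rw [← ENNReal.ofReal_mul (by positivity), ← ENNReal.ofReal_add (by positivity) (by positivity),
    ← ENNReal.ofReal_add (by positivity) (by positivity),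
    ← ENNReal.ofReal_add (by positivity) (by positivity), ← ENNReal.ofReal_one,
    ENNReal.ofReal_le_ofReal_iff (by positivity)] at hI'
  -- The two errors and the shift constant take 3/4 of the total mass 1.
  have h3 : 1 / 4 ≤ 3 / (2 * σ ^ 2) * (m * sqNorm d) := by linarith
  rw [div_le_iff₀ (by positivity)]
  have h4 : σ ^ 2 ≤ 6 * (m * sqNorm d) := by
    have := mul_le_mul_of_nonneg_left h3 (by positivity : 0 ≤ 4 * σ ^ 2)
    field_simp at this
    linarith
  -- The bound 6m is weakened to 8(m + 1), which keeps the denominator positive even for m = 0.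
  nlinarith [mul_nonneg hm0 hd0]

/-- Volume bound on the number of points of a ball with given pairwise separation. -/
lemma card_le_of_separated {M n : ℕ} (u : Fin M → Fin n → ℝ) {r δ : ℝ} (hr : 0 ≤ r) (hδ : 0 < δ)
    (hu : ∀ i, sqNorm (u i) ≤ r ^ 2) (hsep : ∀ i j, i ≠ j → δ ^ 2 ≤ sqNorm (u i - u j)) :
    (M : ℝ) ≤ (1 + 2 * r / δ) ^ n := by
  let v : Fin M → EuclideanSpace ℝ (Fin n) := fun i => WithLp.toLp 2 (u i)
  have hnorm : ∀ x : Fin n → ℝ, ‖(WithLp.toLp 2 x : EuclideanSpace ℝ (Fin n))‖ ^ 2 = sqNorm x := by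
    intro x
    rw [EuclideanSpace.norm_sq_eq]
    simp [sqNorm]
  have hv : ∀ i, ‖v i‖ ≤ r := fun i =>
    (sq_le_sq₀ (norm_nonneg _) hr).1 ((hnorm _).trans_le (hu i))
  have hd : ∀ i j, i ≠ j → δ ≤ dist (v i) (v j) := fun i j hij => by
    rw [dist_eq_norm]
    exact (sq_le_sq₀ hδ.le (norm_nonneg _)).1 ((hsep i j hij).trans_eq (hnorm _).symm)
  set μ : Measure (EuclideanSpace ℝ (Fin n)) := volume
  -- Disjoint balls of radius `δ / 2` inside one of radius `r + δ / 2`: compare volumes.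
  have hdisj : Pairwise (Function.onFun Disjoint fun i => Metric.ball (v i) (δ / 2)) :=
    fun i j hij => Metric.ball_disjoint_ball (by linarith [hd i j hij])
  have hsub : (⋃ i, Metric.ball (v i) (δ / 2)) ⊆ Metric.ball 0 (r + δ / 2) :=
    Set.iUnion_subset fun i => Metric.ball_subset_ball' (by
      rw [dist_zero_right]; linarith [hv i])
  have hle := measure_mono (μ := μ) hsub
  rw [measure_iUnion hdisj fun i => Metric.isOpen_ball.measurableSet] at hle
  simp only [Measure.addHaar_ball_of_pos μ _ (half_pos hδ)] at hle
  rw [Measure.addHaar_ball_of_pos μ _ (by positivity : 0 < r + δ / 2), tsum_fintype, Finset.sum_const,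
    Finset.card_univ, Fintype.card_fin, nsmul_eq_mul, ← mul_assoc,
    ENNReal.mul_le_mul_iff_left (Metric.measure_ball_pos μ _ one_pos).ne'
      measure_ball_lt_top.ne, finrank_euclideanSpace_fin, ← ENNReal.ofReal_natCast,
    ← ENNReal.ofReal_mul (by positivity), ENNReal.ofReal_le_ofReal_iff (by positivity)] at hle
  have e : (1 + 2 * r / δ) = (r + δ / 2) / (δ / 2) := by field_simp; ring
  rw [e, div_pow, le_div_iff₀ (by positivity)]
  exact hle

lemma le_half_of_achievable {Ph : Measure ℝ} [IsProbabilityMeasure Ph]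
    (hint : Integrable (fun x : ℝ => x ^ 2) Ph) {A σ R : ℝ} (hA : 0 < A) (hσ : 0 < σ)
    (hR : Achievable Ph A σ R) : R ≤ 1 / 2 := by
  by_contra! hlt
  set m := ∫ x, x ^ 2 ∂Ph with hm
  have hm0 : 0 ≤ m := integral_nonneg fun x => sq_nonneg x
  set δ := √(σ ^ 2 / (8 * (m + 1))) with hδdef
  have hδ : 0 < δ := by positivity
  set K := 1 + 2 * √A / δ with hK
  have hK1 : 1 ≤ K := by rw [hK]; linarith [show 0 ≤ 2 * √A / δ by positivity]
  have ht : Tendsto (fun n : ℕ => (n : ℝ) ^ (R - 1 / 2)) atTop atTop :=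
    (tendsto_rpow_atTop (sub_pos.2 hlt)).comp tendsto_natCast_atTop_atTop
  obtain ⟨n, ⟨C, hC⟩, hn, hn1⟩ := ((hR.2 (1 / 4) (1 / 4) (by norm_num) (by norm_num)).and
    ((ht.eventually_gt_atTop (2 * K)).and (eventually_ge_atTop 1))).exists
  have hn1' : (1 : ℝ) ≤ n := by exact_mod_cast hn1
  have hn0 : (0 : ℝ) < n := by linarith
  have hcard := card_le_of_separated C.u (Real.sqrt_nonneg (n * A)) hδ
    (fun i => (C.power i).trans_eq (Real.sq_sqrt (by positivity)).symm)
    (fun i j hij => (Real.sq_sqrt (by positivity)).trans_le (hC.le_sqNorm_sub hint hσ hij))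
  have hb : 1 + 2 * √(n * A) / δ ≤ K * √n := by
    rw [Real.sqrt_mul hn0.le, hK]
    have : 1 ≤ √(n : ℝ) := Real.one_le_sqrt.2 hn1'
    have e : (1 + 2 * √A / δ) * √n = √n + 2 * (√n * √A) / δ := by ring
    rw [e]; linarith
  have hKn : 1 ≤ K * √(n : ℝ) := by
    have : 1 ≤ √(n : ℝ) := Real.one_le_sqrt.2 hn1'
    nlinarith
  have h1 : (n : ℝ) ^ ((n : ℝ) * R) < (K * √n) ^ n + 1 :=
    (Nat.lt_floor_add_one _).trans_le (by
      have := hcard.trans (pow_le_pow_left₀ (by positivity) hb n)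
      linarith)
  -- The 1 lost to the floor is absorbed by doubling the base.
  have h2 : (K * √n) ^ n + 1 ≤ (2 * (K * √(n : ℝ))) ^ n := by
    rw [mul_pow 2]
    have h3 : (1 : ℝ) ≤ (K * √n) ^ n := one_le_pow₀ hKn
    have h4 : (2 : ℝ) ≤ 2 ^ n := le_self_pow₀ one_le_two (by omega)
    nlinarith
  have h5 : 2 * (K * √(n : ℝ)) < (n : ℝ) ^ R := by
    have : (n : ℝ) ^ R = (n : ℝ) ^ (R - 1 / 2) * √n := by
      rw [Real.sqrt_eq_rpow, ← Real.rpow_add hn0]; congr 1; ring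
    rw [this, ← mul_assoc]
    exact mul_lt_mul_of_pos_right hn (by positivity)
  have h6 : (2 * (K * √(n : ℝ))) ^ n < ((n : ℝ) ^ R) ^ n :=
    pow_lt_pow_left₀ h5 (by positivity) (by omega)
  rw [← Real.rpow_mul_natCast hn0.le, mul_comm R] at h6
  linarith

theorem capacity_le_half {Ph : Measure ℝ} [IsProbabilityMeasure Ph]
    (hint : Integrable (fun x : ℝ => x ^ 2) Ph) {A σ : ℝ} (hA : 0 < A) (hσ : 0 < σ) :
    capacity Ph A σ ≤ 1 / 2 := by
  refine iSup₂_le fun R hR => ?_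
  have := ENNReal.ofReal_le_ofReal (le_half_of_achievable hint hA hσ hR)
  rwa [ENNReal.ofReal_div_of_pos two_pos, ENNReal.ofReal_one, ENNReal.ofReal_ofNat] at this

/-! ### A Gilbert–Varshamov bound -/

/-- A word of the ball is determined by the set where it differs from `c` (at most `2 ^ n` choices)
and its values there (at most `q ^ k`). -/
lemma card_hammingBall_le {n q : ℕ} (hq : 0 < q) (c : Fin n → Fin q) (k : ℕ) :
    (Finset.univ.filter fun x : Fin n → Fin q => hammingDist x c ≤ k).card ≤ 2 ^ n * q ^ k := by
  classical
  have hsub : (Finset.univ.filter fun x : Fin n → Fin q => hammingDist x c ≤ k) ⊆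
      ((Finset.univ : Finset (Finset (Fin n))).filter fun S => S.card ≤ k).biUnion fun S =>
        Fintype.piFinset fun t => if t ∈ S then Finset.univ else {c t} := by
    intro x hx
    rw [Finset.mem_filter] at hx
    refine Finset.mem_biUnion.2 ⟨Finset.univ.filter fun t => x t ≠ c t, ?_, ?_⟩
    · exact Finset.mem_filter.2 ⟨Finset.mem_univ _, hx.2⟩
    · rw [Fintype.mem_piFinset]
      intro t
      by_cases h : x t = c t <;> simp [h]
  refine (Finset.card_le_card hsub).trans ((Finset.card_biUnion_le_card_mul _ _ (q ^ k) ?_).trans ?_)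
  · intro S hS
    have hS' : S.card ≤ k := (Finset.mem_filter.1 hS).2
    rw [Fintype.card_piFinset]
    calc ∏ t, (if t ∈ S then (Finset.univ : Finset (Fin q)) else {c t}).card
        = ∏ t, if t ∈ S then q else 1 := Finset.prod_congr rfl fun t _ => by split_ifs <;> simp
      _ = q ^ S.card := by simp
      _ ≤ q ^ k := Nat.pow_le_pow_right hq hS'
  · refine Nat.mul_le_mul_right _ ((Finset.card_filter_le _ _).trans ?_)
    simp

/-- In a code of maximal size no word can be added, so the balls of radius `k` around the codewords
cover the space. -/
lemma exists_separated_code {n q : ℕ} (hq : 0 < q) (k : ℕ) :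
    ∃ C : Finset (Fin n → Fin q), (∀ x ∈ C, ∀ y ∈ C, x ≠ y → k < hammingDist x y) ∧
      q ^ n ≤ C.card * (2 ^ n * q ^ k) := by
  classical
  let P : Finset (Fin n → Fin q) → Prop := fun C => ∀ x ∈ C, ∀ y ∈ C, x ≠ y → k < hammingDist x y
  obtain ⟨C, hC, hmax⟩ := Finset.exists_max_image
    ((Finset.univ : Finset (Finset (Fin n → Fin q))).filter P) Finset.card
    ⟨∅, Finset.mem_filter.2 ⟨Finset.mem_univ _, by simp [P]⟩⟩
  have hP : P C := (Finset.mem_filter.1 hC).2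
  refine ⟨C, hP, ?_⟩
  have hcov : (Finset.univ : Finset (Fin n → Fin q)) ⊆
      C.biUnion fun c => Finset.univ.filter fun x => hammingDist x c ≤ k := by
    intro x _
    by_contra hx
    simp only [Finset.mem_biUnion, Finset.mem_filter, Finset.mem_univ, true_and, not_exists,
      not_and, not_le] at hx
    have hxC : x ∉ C := fun h => by simpa using hx x h
    have hins : P (insert x C) := by
      intro a ha b hb hab
      rw [Finset.mem_insert] at ha hb
      rcases ha with rfl | ha <;> rcases hb with rfl | hb
      · exact absurd rfl hab
      · exact hx b hb
      · rw [hammingDist_comm]; exact hx a ha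
      · exact hP a ha b hb hab
    have := hmax _ (Finset.mem_filter.2 ⟨Finset.mem_univ _, hins⟩)
    rw [Finset.card_insert_of_notMem hxC] at this
    omega
  calc q ^ n = (Finset.univ : Finset (Fin n → Fin q)).card := by simp
    _ ≤ _ := Finset.card_le_card hcov
    _ ≤ _ := Finset.card_biUnion_le_card_mul _ _ _ fun c _ => card_hammingBall_le hq c k

/-! ### Error bounds for threshold decoding -/

/-- Expand the square. Unless the noise norm falls short by `T`, the cross term must cancel at least
`sqNorm w - 2 * T`, hence half of `sqNorm w`; Chebyshev bounds both events. -/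
lemma noiseLaw_sqNorm_add_le {σ : ℝ} {n : ℕ} {w : Fin n → ℝ} {T s : ℝ} (hT : 0 < T)
    (hs : 4 * T ≤ s) (hw : s ≤ sqNorm w) :
    noiseLaw σ n {z | sqNorm (z + w) ≤ n * σ ^ 2 + T} ≤
      ENNReal.ofReal (n * Var[fun x => x ^ 2; noise₁ σ] / T ^ 2) +
        ENNReal.ofReal (16 * σ ^ 2 / s) := by
  have hs0 : 0 < s := by linarith
  have hw0 : 0 < sqNorm w := by linarith
  have hsub : {z : Fin n → ℝ | sqNorm (z + w) ≤ n * σ ^ 2 + T} ⊆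
      {z | T ≤ |sqNorm z - n * σ ^ 2|} ∪ {z | sqNorm w / 4 ≤ |∑ t, w t * z t|} := by
    intro z hz
    change sqNorm (z + w) ≤ _ at hz
    rw [sqNorm_add] at hz
    by_cases h : T ≤ |sqNorm z - n * σ ^ 2|
    · exact Or.inl h
    · right
      rw [not_le, abs_lt] at h
      change sqNorm w / 4 ≤ |_|
      rw [le_abs]
      right
      linarith [h.1]
  refine (measure_mono hsub).trans ((measure_union_le _ _).trans (add_le_add
    (noiseLaw_abs_sqNorm_ge_le σ n hT) ((noiseLaw_abs_inner_ge_le σ w (by positivity)).trans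
      (ENNReal.ofReal_le_ofReal ?_))))
  have e : σ ^ 2 * sqNorm w / (sqNorm w / 4) ^ 2 = 16 * σ ^ 2 / sqNorm w := by
    field_simp
    norm_num
  rw [e]
  gcongr

/-- Fading coefficients with indices in `S` rarely fall in `G` less than half as often as expected. -/
lemma fadingLaw_count_lt_le (Ph : Measure ℝ) [IsProbabilityMeasure Ph] {n : ℕ} (S : Finset (Fin n))
    (hS : S.Nonempty) {G : Set ℝ} (hG : MeasurableSet G) (hp : 0 < Ph.real G) :
    fadingLaw Ph n {h | ∑ t ∈ S, G.indicator 1 (h t) < Ph.real G * S.card / 2} ≤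
      ENNReal.ofReal (4 / (Ph.real G ^ 2 * S.card)) := by
  set p := Ph.real G with hpdef
  have hS0 : (0 : ℝ) < S.card := by exact_mod_cast hS.card_pos
  -- Extending by zero off `S` makes the sum run over all coordinates.
  let X : Fin n → ℝ → ℝ := fun t => if t ∈ S then G.indicator 1 else 0
  have hX : ∀ t, MemLp (X t) 2 Ph := by
    intro t
    by_cases ht : t ∈ S
    · simp only [X, ht, if_true]
      exact memLp_indicator_const 2 hG 1 (Or.inr (measure_ne_top _ _))
    · simp [X, ht]
  have hint : ∀ t, ∫ x, X t x ∂Ph = if t ∈ S then p else 0 := by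
    intro t
    by_cases ht : t ∈ S
    · simp only [X, ht, if_true]
      exact integral_indicator_one hG
    · simp [X, ht]
  have hvar : ∀ t, Var[X t; Ph] ≤ if t ∈ S then 1 else 0 := by
    intro t
    by_cases ht : t ∈ S
    · simp only [ht, if_true]
      refine (variance_le_sq_of_bounded (a := 0) (b := 1) (ae_of_all _ fun x => ?_)
        (hX t).1.aemeasurable).trans (by norm_num)
      simp only [X, ht, if_true]
      by_cases hx : x ∈ G <;> simp [hx]
    · simp [X, ht]
  have h := measure_pi_abs_sum_sub_ge_le Ph hX (c := p * S.card / 2) (by positivity)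
  refine (measure_mono fun ω hω => ?_).trans (h.trans (ENNReal.ofReal_le_ofReal ?_))
  · change ∑ t ∈ S, G.indicator (1 : ℝ → ℝ) (ω t) < _ at hω
    change _ ≤ |∑ t, X t (ω t) - ∑ t, ∫ x, X t x ∂Ph|
    have e1 : ∑ t, X t (ω t) = ∑ t ∈ S, G.indicator (1 : ℝ → ℝ) (ω t) := by
      simp [X, ite_apply]
    have e2 : ∑ t, ∫ x, X t x ∂Ph = p * S.card := by
      simp [hint, mul_comm]
    rw [e1, e2, le_abs]
    right
    linarith
  · have : ∑ t, Var[X t; Ph] ≤ S.card := (Finset.sum_le_sum fun t _ => hvar t).trans_eq (by simp)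
    calc _ ≤ (S.card : ℝ) / (p * S.card / 2) ^ 2 := by gcongr
      _ = 4 / (p ^ 2 * S.card) := by field_simp; norm_num

/-- The nonzero reals are a countable union of such sets, so these cannot all be null. -/
lemma exists_pos_measureReal_le_sq {Ph : Measure ℝ} [IsProbabilityMeasure Ph] (h0 : Ph {0} < 1) :
    ∃ c : ℝ, 0 < c ∧ 0 < Ph.real {x | c ≤ x ^ 2} := by
  by_contra! hcon
  have hz : ∀ k : ℕ, Ph {x | 1 / ((k : ℝ) + 1) ≤ x ^ 2} = 0 := fun k =>
    (measureReal_eq_zero_iff (measure_ne_top _ _)).1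
      (le_antisymm (hcon _ (by positivity)) measureReal_nonneg)
  have hsub : ({0}ᶜ : Set ℝ) ⊆ ⋃ k : ℕ, {x | 1 / ((k : ℝ) + 1) ≤ x ^ 2} := by
    intro x hx
    obtain ⟨k, hk⟩ := exists_nat_one_div_lt (show (0 : ℝ) < x ^ 2 by
      have : x ≠ 0 := hx
      positivity)
    exact Set.mem_iUnion.2 ⟨k, hk.le⟩
  have hc : Ph {0}ᶜ = 0 := measure_mono_null hsub (measure_iUnion_null hz)
  exact h0.ne ((prob_compl_eq_zero_iff (measurableSet_singleton 0)).1 hc)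

/-- The code with codewords `u` whose decoder accepts the `i`-th message if the squared distance of
the output to `𝐡 𝐮ᵢ` is at most `r`. -/
def thresholdCode {A : ℝ} {M n : ℕ} (u : Fin M → Fin n → ℝ) (hu : ∀ i, sqNorm (u i) ≤ n * A)
    (r : ℝ) : DICode A M n where
  u := u
  D i h := {y | sqNorm (y - h * u i) ≤ r}
  power := hu
  measurable_D i := measurableSet_le ((measurable_sqNorm n).comp (by fun_prop)) measurable_const

/-- A type I error needs an unusually large noise norm. A type II error needs one of three events of
probability at most `l`: fading that shrinks the distance below `s`, a small noise norm, or a large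
projection of the noise on the difference. -/
lemma thresholdCode_isReliable {Ph : Measure ℝ} [IsProbabilityMeasure Ph] {A σ : ℝ} (hσ : 0 < σ)
    {M n : ℕ} (u : Fin M → Fin n → ℝ) (hu : ∀ i, sqNorm (u i) ≤ n * A) {T s l₁ l₂ l : ℝ}
    (hT : 0 < T) (hs : 4 * T ≤ s) (hl₁ : l ≤ l₁) (hl₂ : 3 * l ≤ l₂)
    (hV : n * Var[fun x => x ^ 2; noise₁ σ] / T ^ 2 ≤ l) (hσs : 16 * σ ^ 2 / s ≤ l)
    (hfade : ∀ i j, i ≠ j →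
      fadingLaw Ph n {h | sqNorm (h * (u i - u j)) < s} ≤ ENNReal.ofReal l) :
    (thresholdCode u hu (n * σ ^ 2 + T)).IsReliable Ph σ l₁ l₂ := by
  have hl0 : 0 ≤ l := le_trans (by have := variance_nonneg (fun x => x ^ 2) (noise₁ σ); positivity) hV
  constructor
  · intro i
    rw [DICode.err₁_eq hσ]
    calc _ ≤ ∫⁻ _, ENNReal.ofReal l₁ ∂fadingLaw Ph n := lintegral_mono fun h => ?_
      _ = _ := by simp
    refine (measure_mono fun z hz => ?_).trans ((noiseLaw_abs_sqNorm_ge_le σ n hT).trans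
      (ENNReal.ofReal_le_ofReal (hV.trans hl₁)))
    change ¬ sqNorm (z + h * u i - h * u i) ≤ _ at hz
    rw [add_sub_cancel_right, not_le] at hz
    change T ≤ |_|
    rw [le_abs]
    left
    linarith
  · intro i j hij
    rw [DICode.err₂_eq hσ]
    set B := {h : Fin n → ℝ | sqNorm (h * (u i - u j)) < s} with hB
    have hBm : MeasurableSet B :=
      measurableSet_lt ((measurable_sqNorm n).comp (by fun_prop)) measurable_const
    calc _ ≤ ∫⁻ h, (ENNReal.ofReal l + ENNReal.ofReal l) + B.indicator 1 h ∂fadingLaw Ph n :=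
          lintegral_mono fun h => ?_
      _ = ENNReal.ofReal l + ENNReal.ofReal l + fadingLaw Ph n B := by
          rw [lintegral_add_left measurable_const, lintegral_indicator_one hBm]; simp
      _ ≤ ENNReal.ofReal l + ENNReal.ofReal l + ENNReal.ofReal l :=
          add_le_add le_rfl (hfade i j hij)
      _ = ENNReal.ofReal (3 * l) := by
          rw [← ENNReal.ofReal_add hl0 hl0, ← ENNReal.ofReal_add (by positivity) hl0]
          congr 1; ring
      _ ≤ _ := ENNReal.ofReal_le_ofReal hl₂
    by_cases hh : h ∈ B
    · rw [Set.indicator_of_mem hh]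
      exact prob_le_one.trans (by simp)
    · rw [Set.indicator_of_notMem hh, add_zero]
      have he : {z : Fin n → ℝ | z + h * u i ∈ {y | sqNorm (y - h * u j) ≤ n * σ ^ 2 + T}} =
          {z | sqNorm (z + h * (u i - u j)) ≤ n * σ ^ 2 + T} := by
        ext z
        change sqNorm _ ≤ _ ↔ sqNorm _ ≤ _
        rw [mul_sub, add_sub_assoc]
      change noiseLaw σ n {z : Fin n → ℝ |
        z + h * u i ∈ {y | sqNorm (y - h * u j) ≤ n * σ ^ 2 + T}} ≤ _
      rw [he]
      exact (noiseLaw_sqNorm_add_le hT hs (not_lt.1 hh)).trans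
        (add_le_add (ENNReal.ofReal_le_ofReal hV) (ENNReal.ofReal_le_ofReal hσs))

/-! ### Codewords on a grid -/

/-- The codeword in `[0, √A]ⁿ` with the coordinates `√A xₜ / q`. -/
def gridPoint (A : ℝ) {n q : ℕ} (x : Fin n → Fin q) : Fin n → ℝ := fun t => √A * ((x t : ℕ) / q)

lemma sqNorm_gridPoint_le {A : ℝ} (hA : 0 ≤ A) {n q : ℕ} (x : Fin n → Fin q) :
    sqNorm (gridPoint A x) ≤ n * A := by
  have h : ∀ t, gridPoint A x t ^ 2 ≤ A := by
    intro t
    rw [gridPoint, mul_pow, Real.sq_sqrt hA]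
    have h1 : ((x t : ℕ) : ℝ) / q ≤ 1 :=
      div_le_one_of_le₀ (by exact_mod_cast (x t).2.le) (by positivity)
    exact mul_le_of_le_one_right hA (pow_le_one₀ (by positivity) h1)
  exact (Finset.sum_le_sum fun t _ => h t).trans_eq (by simp)

/-- Distinct levels are at least `√A / q` apart, so each differing coordinate with `c ≤ h t ^ 2`
contributes at least `A / q ^ 2 * c`. -/
lemma le_sqNorm_mul_gridPoint_sub {A : ℝ} (hA : 0 ≤ A) {n q : ℕ} (x y : Fin n → Fin q)
    (c : ℝ) (h : Fin n → ℝ) :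
    A / q ^ 2 * c * ∑ t ∈ Finset.univ.filter (fun t => x t ≠ y t),
        ({a : ℝ | c ≤ a ^ 2}.indicator 1 (h t) : ℝ) ≤
      sqNorm (h * (gridPoint A x - gridPoint A y)) := by
  rw [sqNorm, Finset.mul_sum]
  refine (Finset.sum_le_sum fun t ht => ?_).trans
    (Finset.sum_le_univ_sum_of_nonneg fun t => sq_nonneg _)
  have hxy : x t ≠ y t := (Finset.mem_filter.1 ht).2
  have h1 : (1 : ℝ) ≤ (((x t : ℕ) : ℝ) - (y t : ℕ)) ^ 2 := by
    have hz : (((x t : ℕ) : ℤ) - (y t : ℕ)) ≠ 0 := by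
      rw [sub_ne_zero]
      exact fun e => hxy (Fin.ext (by exact_mod_cast e))
    have := Int.one_le_abs hz
    have h2 : (1 : ℤ) ≤ (((x t : ℕ) : ℤ) - (y t : ℕ)) ^ 2 := by
      rw [← sq_abs]; nlinarith
    exact_mod_cast h2
  have e : (h * (gridPoint A x - gridPoint A y)) t ^ 2 =
      A / q ^ 2 * h t ^ 2 * (((x t : ℕ) : ℝ) - (y t : ℕ)) ^ 2 := by
    simp only [Pi.mul_apply, Pi.sub_apply, gridPoint]
    calc _ = √A ^ 2 * (h t ^ 2 * (((x t : ℕ) : ℝ) / q - (y t : ℕ) / q) ^ 2) := by ring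
      _ = _ := by rw [Real.sq_sqrt hA, ← sub_div, div_pow]; ring
  rw [e]
  have hAq : 0 ≤ A / (q : ℝ) ^ 2 := by positivity
  by_cases ht : h t ∈ {a : ℝ | c ≤ a ^ 2}
  · rw [Set.indicator_of_mem ht, Pi.one_apply, mul_one]
    have ht' : c ≤ h t ^ 2 := ht
    calc A / q ^ 2 * c ≤ A / q ^ 2 * h t ^ 2 := by gcongr
      _ ≤ _ := le_mul_of_one_le_right (by positivity) h1
  · rw [Set.indicator_of_notMem ht, mul_zero]
    positivity

/-! ### Achievability -/

/-- With `q ≥ n ^ b` grid levels, a code of relative distance `θ` can have `n ^ (n R)` words. -/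
lemma rpow_le_card {n q M : ℕ} {b θ R : ℝ} (hn : 0 < n) (hθ0 : 0 ≤ θ) (hθ1 : θ ≤ 1)
    (hq0 : 0 < q) (hq : (n : ℝ) ^ b ≤ q) (hgap : 2 ≤ (n : ℝ) ^ (b * (1 - θ) - R))
    (hM : q ^ n ≤ M * (2 ^ n * q ^ ⌊θ * n⌋₊)) : (n : ℝ) ^ ((n : ℝ) * R) ≤ M := by
  have hn0 : (0 : ℝ) < n := by exact_mod_cast hn
  have hq1 : (1 : ℝ) ≤ q := by exact_mod_cast hq0
  have hq0' : (0 : ℝ) < q := by linarith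
  have hM' : (q : ℝ) ^ (n : ℝ) ≤ M * (2 ^ n * (q : ℝ) ^ (θ * n)) := by
    have h1 : (q : ℝ) ^ n ≤ M * (2 ^ n * (q : ℝ) ^ ⌊θ * n⌋₊) := by exact_mod_cast hM
    rw [Real.rpow_natCast]
    refine h1.trans ?_
    gcongr
    rw [← Real.rpow_natCast]
    exact Real.rpow_le_rpow_of_exponent_le hq1 (Nat.floor_le (by positivity))
  have h2 : ((q : ℝ) ^ (1 - θ)) ^ n ≤ M * 2 ^ n := by
    have e : (q : ℝ) ^ (n : ℝ) = ((q : ℝ) ^ (1 - θ)) ^ n * (q : ℝ) ^ (θ * n) := by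
      rw [← Real.rpow_mul_natCast hq0'.le, ← Real.rpow_add hq0']
      congr 1; ring
    rw [e, ← mul_assoc] at hM'
    exact le_of_mul_le_mul_right hM' (by positivity)
  -- The gap in the exponent pays for the factor `2 ^ n` of the Hamming ball bound.
  have h3 : 2 * (n : ℝ) ^ R ≤ (q : ℝ) ^ (1 - θ) := by
    calc 2 * (n : ℝ) ^ R ≤ (n : ℝ) ^ (b * (1 - θ) - R) * (n : ℝ) ^ R := by gcongr
      _ = ((n : ℝ) ^ b) ^ (1 - θ) := by
        rw [← Real.rpow_add hn0, ← Real.rpow_mul hn0.le, sub_add_cancel]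
      _ ≤ _ := Real.rpow_le_rpow (by positivity) hq (by linarith)
  have h4 := (pow_le_pow_left₀ (by positivity) h3 n).trans h2
  rw [mul_pow, mul_comm (M : ℝ), ← Real.rpow_mul_natCast hn0.le, mul_comm R] at h4
  exact le_of_mul_le_mul_left h4 (by positivity)

/-- Every rate below `1/4` is achievable unless the fading vanishes almost surely. -/
theorem achievable_of_lt_quarter {Ph : Measure ℝ} [IsProbabilityMeasure Ph] (h0 : Ph {0} < 1)
    {A σ R : ℝ} (hA : 0 < A) (hσ : 0 < σ) (hR0 : 0 < R) (hR : R < 1 / 4) :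
    Achievable Ph A σ R := by
  refine ⟨hR0, fun l₁ l₂ hl₁ hl₂ => ?_⟩
  obtain ⟨c, hc, hp⟩ := exists_pos_measureReal_le_sq h0
  set G : Set ℝ := {x | c ≤ x ^ 2} with hG
  have hGm : MeasurableSet G := measurableSet_le measurable_const (by fun_prop)
  set p := Ph.real G with hpdef
  obtain ⟨b, hRb, hb4⟩ := exists_between hR
  have hb0 : 0 < b := hR0.trans hRb
  obtain ⟨θ, hθ0, hθ⟩ := exists_between (show 0 < 1 - R / b by
    rw [sub_pos, div_lt_one hb0]; exact hRb)
  have hθ1 : θ < 1 := by linarith [div_pos hR0 hb0]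
  have hgap : 0 < b * (1 - θ) - R := by
    have : R / b < 1 - θ := by linarith
    rw [div_lt_iff₀ hb0] at this
    linarith
  set l := min l₁ (l₂ / 3) with hl
  have hl0 : 0 < l := lt_min hl₁ (by positivity)
  set V := Var[fun x => x ^ 2; noise₁ σ] with hV
  have hV0 : 0 ≤ V := variance_nonneg _ _
  set K := √((V + 1) / l) with hK
  have hK0 : 0 < K := by positivity
  have hK2 : V / K ^ 2 ≤ l := by
    rw [hK, Real.sq_sqrt (by positivity), div_div_eq_mul_div, div_le_iff₀ (by positivity)]
    nlinarith
  -- The 8 is 4 from `q ≤ 2 * n ^ b`, squared, times 2 from halving the expected count.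
  set κ := A * c * p * θ / 8 with hκ
  have hκ0 : 0 < κ := by positivity
  have tN : Tendsto (fun n : ℕ => (n : ℝ)) atTop atTop := tendsto_natCast_atTop_atTop
  -- In turn: enough codewords; `4 * T ≤ s`, which is where `b < 1/4` enters; small noise
  -- projection; reliable fading count.
  have t1 := ((tendsto_rpow_atTop hgap).comp tN).eventually_ge_atTop 2
  have t2 := ((tendsto_rpow_atTop (show 0 < 1 / 2 - 2 * b by linarith)).comp
    tN).eventually_ge_atTop (4 * K / κ)
  have t3 := ((tendsto_rpow_atTop (show 0 < 1 - 2 * b by linarith)).comp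
    tN).eventually_ge_atTop (16 * σ ^ 2 / l / κ)
  have t4 := tN.eventually_ge_atTop (4 / (p ^ 2 * θ) / l)
  filter_upwards [t1, t2, t3, t4, eventually_ge_atTop 1] with n h1 h2 h3 h4 hn
  simp only [Function.comp_apply] at h1 h2 h3
  have hn1 : (1 : ℝ) ≤ n := by exact_mod_cast hn
  have hn0 : (0 : ℝ) < n := by linarith
  have hnb : 1 ≤ (n : ℝ) ^ b := Real.one_le_rpow hn1 hb0.le
  set q := ⌈(n : ℝ) ^ b⌉₊ with hq
  have hq0 : 0 < q := Nat.ceil_pos.2 (by linarith)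
  have hqn : (n : ℝ) ^ b ≤ q := Nat.le_ceil _
  have hq2 : (q : ℝ) ≤ 2 * (n : ℝ) ^ b := by
    linarith [Nat.ceil_lt_add_one (show 0 ≤ (n : ℝ) ^ b by linarith)]
  obtain ⟨W, hsep, hcard⟩ := exists_separated_code (n := n) hq0 ⌊θ * n⌋₊
  have hM : ⌊(n : ℝ) ^ ((n : ℝ) * R)⌋₊ ≤ W.card :=
    Nat.floor_le_of_le (rpow_le_card hn hθ0.le hθ1.le hq0 hqn h1 hcard)
  let x : Fin ⌊(n : ℝ) ^ ((n : ℝ) * R)⌋₊ → Fin n → Fin q := fun i =>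
    W.equivFin.symm (Fin.castLE hM i)
  have hx : ∀ i j, i ≠ j → ⌊θ * n⌋₊ < hammingDist (x i) (x j) := fun i j hij =>
    hsep _ (Subtype.prop _) _ (Subtype.prop _) fun e => hij (by simpa using Subtype.ext e)
  have hsn : κ * (n : ℝ) ^ (1 - 2 * b) = A / (2 * (n : ℝ) ^ b) ^ 2 * c * (p * (θ * n) / 2) := by
    have e : (n : ℝ) ^ (1 - 2 * b) = n / ((n : ℝ) ^ b) ^ 2 := by
      rw [Real.rpow_sub hn0, Real.rpow_one, ← Real.rpow_mul_natCast hn0.le, mul_comm b]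
      norm_num
    rw [e, hκ]
    field_simp
    norm_num
  refine ⟨thresholdCode (fun i => gridPoint A (x i)) (fun i => sqNorm_gridPoint_le hA.le _) _,
    thresholdCode_isReliable hσ _ _ (T := K * √n) (s := κ * (n : ℝ) ^ (1 - 2 * b)) (l := l)
      (by positivity) ?_ (min_le_left _ _) ?_ ?_ ?_ ?_⟩
  · rw [div_le_iff₀ hκ0] at h2
    have e : (n : ℝ) ^ (1 - 2 * b) = (n : ℝ) ^ (1 / 2 - 2 * b) * √n := by
      rw [Real.sqrt_eq_rpow, ← Real.rpow_add hn0]; congr 1; ring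
    rw [e]
    calc 4 * (K * √n) = 4 * K * √n := by ring
      _ ≤ (n : ℝ) ^ (1 / 2 - 2 * b) * κ * √n := by gcongr
      _ = _ := by ring
  · linarith [min_le_right l₁ (l₂ / 3)]
  · rw [mul_pow, Real.sq_sqrt hn0.le, ← hV]
    calc n * V / (K ^ 2 * n) = V / K ^ 2 := by field_simp
      _ ≤ l := hK2
  · rw [div_le_iff₀ hκ0, div_le_iff₀ hl0] at h3
    rw [div_le_iff₀ (by positivity)]
    linarith
  · intro i j hij
    set S := Finset.univ.filter fun t => x i t ≠ x j t with hS
    have hSc : ⌊θ * n⌋₊ < S.card := hx i j hij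
    have hSn : θ * n ≤ S.card :=
      ((Nat.lt_floor_add_one _).trans_le (by exact_mod_cast hSc)).le
    have hSp : (0 : ℝ) < S.card := by exact_mod_cast Nat.zero_lt_of_lt hSc
    refine (measure_mono fun h hh => ?_).trans ((fadingLaw_count_lt_le Ph S
      (Finset.card_pos.1 (Nat.zero_lt_of_lt hSc)) hGm hp).trans (ENNReal.ofReal_le_ofReal ?_))
    · change sqNorm _ < _ at hh
      change ∑ t ∈ S, G.indicator (1 : ℝ → ℝ) (h t) < p * S.card / 2
      by_contra! hcon
      refine absurd hh (not_lt.2 (le_trans ?_ (le_sqNorm_mul_gridPoint_sub hA.le (x i) (x j) c h)))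
      rw [hsn]
      gcongr ?_ * c * ?_
      · gcongr
      · refine le_trans ?_ hcon
        gcongr
    · rw [← hpdef, div_le_iff₀ (by positivity)]
      rw [div_div, div_le_iff₀ (by positivity)] at h4
      have : p ^ 2 * l * (θ * n) ≤ p ^ 2 * l * S.card := by gcongr
      linarith

theorem quarter_le_capacity {Ph : Measure ℝ} [IsProbabilityMeasure Ph] (h0 : Ph {0} < 1)
    {A σ : ℝ} (hA : 0 < A) (hσ : 0 < σ) : 1 / 4 ≤ capacity Ph A σ := by
  have e : (1 / 4 : ℝ≥0∞) = ENNReal.ofReal (1 / 4) := by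
    rw [ENNReal.ofReal_div_of_pos (by norm_num), ENNReal.ofReal_one, ENNReal.ofReal_ofNat]
  rw [e]
  refine le_of_forall_lt fun a ha => ?_
  have ha' : a ≠ ∞ := ha.ne_top
  rw [← ENNReal.ofReal_toReal ha', ENNReal.ofReal_lt_ofReal_iff (by norm_num)] at ha
  obtain ⟨R, haR, hR⟩ := exists_between ha
  have hR0 : 0 < R := ENNReal.toReal_nonneg.trans_lt haR
  calc a = ENNReal.ofReal a.toReal := (ENNReal.ofReal_toReal ha').symm
    _ < ENNReal.ofReal R := (ENNReal.ofReal_lt_ofReal_iff hR0).2 haR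
    _ ≤ capacity Ph A σ := le_iSup₂ (f := fun (R : ℝ) (_ : Achievable Ph A σ R) =>
        ENNReal.ofReal R) R (achievable_of_lt_quarter h0 hA hσ hR0 hR)

end

end FastFading

theorem mainTheorem3 (Ph : Measure ℝ) [IsProbabilityMeasure Ph] (A σ : ℝ) (hA : 0 < A)
    (hσ : 0 < σ) :
    (Integrable (fun x : ℝ => x ^ 2) Ph → FastFading.capacity Ph A σ ≤ 1 / 2) ∧
    (Ph {0} = 0 → 1 / 4 ≤ FastFading.capacity Ph A σ) ∧
    (Ph {0} < 1 → Integrable (fun x : ℝ => x ^ 4) Ph → 1 / 4 ≤ FastFading.capacity Ph A σ) :=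
  ⟨fun h => FastFading.capacity_le_half h hA hσ,
    fun h => FastFading.quarter_le_capacity (by rw [h]; exact one_pos) hA hσ,
    fun h _ => FastFading.quarter_le_capacity h hA hσ⟩
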